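/- Let $\lambda:[0,\infty)\to[0,\infty)$ be continuous, $\mu>0$, $\theta\ge 0$, and let $c\ge 1$ be an integer. Let $Q=(Q(t))_{t\ge0}$ be the (nonstationary) Erlang-A, i.e. $M(t)/M/c+M$, queue length process: the $\mathbb{N}$-valued Markov jump process with right-continuous paths with left limits that jumps at time $t$ from $n$ to $n+1$ at rate $\lambda(t)$ and from $n$ to $n-1$ at rate $\mu\,(n\wedge c)+\theta\,(n-c)^+$ (formally, a solution of the martingale problem for this generator). Let $T\ge 0$ and let $J\subseteq\mathbb{R}$ be an interval containing $0$ (for instance $[0,\infty)$ or $\mathbb{R}$) such that $E[e^{\alpha Q(0)}]<\infty$ for all $\alpha\in J$. Let $M_f(t,\alpha)=E[e^{\alpha Q_f(t)}]$ denote the fluid approximation of the moment generating function, that is, a continuous, positive, classical solution on $[0,T]\times J$ of $$\frac{\partial M_f}{\partial t}=\lambda(t)(e^{\alpha}-1)M_f+\theta(e^{-\alpha}-1)\frac{\partial M_f}{\partial\alpha}-(\theta-\mu)(e^{-\alpha}-1)\Big(\frac{\partial M_f}{\partial\alpha}\wedge c\,M_f\Big),$$ with the same initial value as $Q$, i.e.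 $M_f(0,\alpha)=E[e^{\alpha Q(0)}]$ for $\alpha\in J$. Then for all $t\in[0,T]$ and $\alpha\in J$, $E[e^{\alpha Q(t)}]$ is finite and: - if $\alpha\ge 0$, then $\log E[e^{\alpha Q(t)}]\ge\log E[e^{\alpha Q_f(t)}]$ when $\theta<\mu$, and $\log E[e^{\alpha Q(t)}]\le\log E[e^{\alpha Q_f(t)}]$ when $\theta>\mu$; - if $\alpha\le 0$, both inequalities are reversed: $\log E[e^{\alpha Q(t)}]\le\log E[e^{\alpha Q_f(t)}]$ when $\theta<\mu$, and $\log E[e^{\alpha Q(t)}]\ge\log E[e^{\alpha Q_f(t)}]$ when $\theta>\mu$; - if $\theta=\mu$, then $\log E[e^{\alpha Q(t)}]=\log E[e^{\alpha Q_f(t)}]$. -/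

import Mathlib

open MeasureTheory ProbabilityTheory Set Filter Topology
open scoped NNReal

noncomputable section

/-- The total departure rate `δ(x, c) = μ (x ∧ c) + θ (x - c)⁺` of the Erlang-A queue with service
rate `μ`, abandonment rate `θ` and `c` servers, when `x` customers are present. -/
def erlangDepartureRate (μ θ : ℝ) (c : ℕ) (x : ℝ) : ℝ :=
  μ * min x c + θ * max (x - c) 0

/-- The generator at time `s` of the `M(t)/M/c+M` queue: arrivals (`n → n + 1`) at rate `lam s`,
departures (`n → n - 1`) at rate `δ(n, c)`. As `δ(0, c) = 0`, the truncated subtraction is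
harmless at `n = 0`. -/
def erlangGenerator (lam : ℝ → ℝ) (μ θ : ℝ) (c : ℕ) (s : ℝ) (f : ℕ → ℝ) (n : ℕ) : ℝ :=
  lam s * (f (n + 1) - f n) + erlangDepartureRate μ θ c n * (f (n - 1) - f n)

/-- `Q` is a (nonstationary) Erlang-A queue length process, as the solution of the martingale
problem for its generator: `Q` takes values in `ℕ`, has right-continuous paths with left limits
(for the discrete topology of `ℕ`), is adapted to `ℱ`, and for each finitely supported `f`
`f(Q(t)) - f(Q(0)) - ∫₀ᵗ (A_s f)(Q(s)) ds` is an `ℱ`-martingale. -/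
structure IsErlangA {Ω : Type*} [mΩ : MeasurableSpace Ω] (P : Measure Ω) (ℱ : Filtration ℝ≥0 mΩ)
    (lam : ℝ → ℝ) (μ θ : ℝ) (c : ℕ) (Q : ℝ≥0 → Ω → ℕ) : Prop where
  adapted : ∀ t, Measurable[ℱ t] (Q t)
  rightCont : ∀ ω t, ContinuousWithinAt (fun s => Q s ω) (Ici t) t
  leftLim : ∀ ω t, ∃ l, Tendsto (fun s => Q s ω) (𝓝[<] t) (𝓝 l)
  martingale : ∀ f : ℕ → ℝ, f.support.Finite →
    Martingale (fun (t : ℝ≥0) ω => f (Q t ω) - f (Q 0 ω) -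
      ∫ s in (0 : ℝ)..t, erlangGenerator lam μ θ c s f (Q s.toNNReal ω)) ℱ P

/-- `M t α` is a (positive, classical) solution for `0 ≤ t ≤ T`, `α ∈ J` of the partial
differential equation that defines the fluid approximation `M_f(t, α) = E[e^{α Q_f(t)}]` of the
moment generating function,
`∂M/∂t = lam(t) (e^α - 1) M + θ (e^{-α} - 1) ∂M/∂α - (θ - μ) (e^{-α} - 1) (∂M/∂α ∧ c M)`.
Derivatives at end points of `[0, T]` and of the interval `J` are one-sided. -/
structure IsFluidMGF (lam : ℝ → ℝ) (μ θ : ℝ) (c : ℕ) (T : ℝ) (J : Set ℝ) (M : ℝ → ℝ → ℝ) :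
    Prop where
  pos : ∀ t ∈ Icc 0 T, ∀ α ∈ J, 0 < M t α
  cont : ContinuousOn (fun x : ℝ × ℝ => M x.1 x.2) (Icc 0 T ×ˢ J)
  pde : ∀ t ∈ Icc 0 T, ∀ α ∈ J, ∃ p : ℝ,
    HasDerivWithinAt (fun a => M t a) p J α ∧
    HasDerivWithinAt (fun s => M s α)
      (lam t * (Real.exp α - 1) * M t α + θ * (Real.exp (-α) - 1) * p
        - (θ - μ) * (Real.exp (-α) - 1) * min p (c * M t α)) (Icc 0 T) t

end

/-!
Dynkin's formula for `e^{αQ}` gives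
`∂M/∂t = lam(t) (e^α - 1) M + (e^{-α} - 1) E[δ(Q, c) e^{αQ}]` for `M(t, α) = E[e^{αQ(t)}]`, with
`δ(Q, c) = θ Q + (μ - θ) (Q ∧ c)`. The fluid equation replaces `E[(Q ∧ c) e^{αQ}]` by the larger
`∂M/∂α ∧ c M`, so `M` is a supersolution of it where `(μ - θ) α ≥ 0` and a subsolution where
`(μ - θ) α ≤ 0`. The comparison principle for this first-order equation needs no boundary
condition apart from `M(t, 0) = 1`: the coefficient `e^{-α} - 1` of `∂M/∂α` makes the
characteristics point away from `α = 0`, so an outer boundary point can be treated like an interior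
one. Finiteness of `M` and the validity of Dynkin's formula for unbounded functions follow by
truncation, from a Grönwall bound uniform in the truncation level.
-/

theorem sub_mul_nonpos_of_isLocalMaxOn {f : ℝ → ℝ} {s : Set ℝ} {x y d : ℝ}
    (hf : HasDerivWithinAt f d s x) (hmax : IsLocalMaxOn f s x) (hs : segment ℝ x y ⊆ s) :
    (y - x) * d ≤ 0 := by
  simpa using hmax.hasFDerivWithinAt_nonpos hf.hasFDerivWithinAt
    (sub_mem_posTangentConeAt_of_segment_subset hs)

/- Weighting `w` by `exp (-(K + 1) t)` makes the time derivative negative at a positive maximum. -/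
theorem nonpos_of_deriv_le_at_spatial_max {X : Type*} [TopologicalSpace X] {S : Set X}
    (hS : IsCompact S) {T K : ℝ} {w : ℝ → X → ℝ}
    (hw : ContinuousOn (Function.uncurry w) (Icc 0 T ×ˢ S))
    (h0 : ∀ x ∈ S, w 0 x ≤ 0)
    (hd : ∀ t ∈ Ioc 0 T, ∀ x ∈ S, 0 < w t x → IsMaxOn (w t) S x →
      ∃ d, HasDerivWithinAt (fun s => w s x) d (Icc 0 T) t ∧ d ≤ K * w t x) :
    ∀ t ∈ Icc 0 T, ∀ x ∈ S, w t x ≤ 0 := by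
  intro t₀ ht₀ x₀ hx₀
  by_contra! hpos
  set e : ℝ → ℝ := fun s => Real.exp (-(K + 1) * s)
  have he : ∀ s, 0 < e s := fun s => Real.exp_pos _
  have hcont : ContinuousOn (fun z : ℝ × X => e z.1 * w z.1 z.2) (Icc 0 T ×ˢ S) :=
    ContinuousOn.mul (by fun_prop) hw
  obtain ⟨⟨t, x⟩, ⟨ht, hx⟩, hmax⟩ :=
    (isCompact_Icc.prod hS).exists_isMaxOn ⟨(t₀, x₀), ht₀, hx₀⟩ hcont
  have hle : ∀ s ∈ Icc 0 T, ∀ y ∈ S, e s * w s y ≤ e t * w t x :=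
    fun s hs y hy => hmax (mk_mem_prod hs hy)
  have hwpos : 0 < w t x :=
    pos_of_mul_pos_right ((mul_pos (he t₀) hpos).trans_le (hle t₀ ht₀ x₀ hx₀)) (he t).le
  have htpos : 0 < t := ht.1.lt_of_ne fun h => (h0 x hx).not_gt (h ▸ hwpos)
  have hspace : IsMaxOn (w t) S x := fun y hy => le_of_mul_le_mul_left (hle t ht y hy) (he t)
  obtain ⟨d, hd, hdle⟩ := hd t ⟨htpos, ht.2⟩ x hx hwpos hspace
  have hder : HasDerivWithinAt (fun s => e s * w s x)
      (e t * (-(K + 1)) * w t x + e t * d) (Icc 0 T) t := by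
    refine HasDerivWithinAt.mul (HasDerivAt.hasDerivWithinAt ?_) hd
    simpa only [id, mul_one] using ((hasDerivAt_id t).const_mul (-(K + 1))).exp
  have htime : (0 - t) * (e t * (-(K + 1)) * w t x + e t * d) ≤ 0 := by
    refine sub_mul_nonpos_of_isLocalMaxOn hder (IsMaxOn.localize fun s hs => hle s hs x hx) ?_
    rw [segment_symm, segment_eq_Icc ht.1]
    exact Icc_subset_Icc_right ht.2
  have hneg : e t * (d - K * w t x - w t x) < 0 := mul_neg_of_pos_of_neg (he t) (by linarith)
  nlinarith

section SeparateContinuity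

variable {X Y Z : Type*} [TopologicalSpace X] [LinearOrder Y] [TopologicalSpace Y]
  [OrderTopology Y] [LinearOrder Z] [TopologicalSpace Z] [OrderTopology Z]
  {f : X → Y → Z} {s : Set X} {t : Set Y}

theorem eventually_lt_of_monotoneOn {x₀ : X} {y₀ : Y} {l : Z}
    (hx : ∀ y ∈ t, ContinuousWithinAt (f · y) s x₀) (hy : ContinuousWithinAt (f x₀) t y₀)
    (hmono : ∀ x ∈ s, MonotoneOn (f x) t) (hy₀ : y₀ ∈ t) (hl : l < f x₀ y₀) :
    ∀ᶠ z in 𝓝[s ×ˢ t] (x₀, y₀), l < f z.1 z.2 := by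
  obtain ⟨b, hbt, hlb, hb⟩ : ∃ b ∈ t, l < f x₀ b ∧ ∀ᶠ y in 𝓝[t] y₀, b ≤ y := by
    by_cases h : (𝓝[t ∩ Iio y₀] y₀).NeBot
    · have hev : ∀ᶠ b in 𝓝[t ∩ Iio y₀] y₀, l < f x₀ b :=
        (hy.mono inter_subset_left).eventually (lt_mem_nhds hl)
      obtain ⟨b, hlb, hbt, hb⟩ := (hev.and self_mem_nhdsWithin).exists
      exact ⟨b, hbt, hlb, mem_nhdsWithin_of_mem_nhds (Ici_mem_nhds hb)⟩
    · rw [not_neBot, nhdsWithin_inter', inf_principal_eq_bot, compl_Iio] at h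
      exact ⟨y₀, hy₀, hl, h⟩
  rw [nhdsWithin_prod_eq]
  filter_upwards [(((hx b hbt).eventually (lt_mem_nhds hlb)).and self_mem_nhdsWithin).prod_mk
    (hb.and self_mem_nhdsWithin)] with ⟨x, y⟩ ⟨⟨hlx, hxs⟩, hby, hyt⟩
  exact hlx.trans_le (hmono x hxs hbt hyt hby)

theorem continuousOn_uncurry_of_monotoneOn (hx : ∀ y ∈ t, ContinuousOn (f · y) s)
    (hy : ∀ x ∈ s, ContinuousOn (f x) t) (hmono : ∀ x ∈ s, MonotoneOn (f x) t) :
    ContinuousOn (Function.uncurry f) (s ×ˢ t) := by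
  rintro ⟨x₀, y₀⟩ ⟨hx₀, hy₀⟩
  refine tendsto_order.2 ⟨fun l hl => ?_, fun u hu => ?_⟩
  · exact eventually_lt_of_monotoneOn (fun y h => hx y h x₀ hx₀) (hy x₀ hx₀ y₀ hy₀) hmono hy₀ hl
  · exact eventually_lt_of_monotoneOn (Y := Yᵒᵈ) (Z := Zᵒᵈ) (fun y h => hx y h x₀ hx₀)
      (hy x₀ hx₀ y₀ hy₀) (fun x h => (hmono x h).dual) hy₀ hu

end SeparateContinuity

theorem hasDerivWithinAt_Icc_of_eq_add_integral {u g : ℝ → ℝ} {T C : ℝ}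
    (hg : ContinuousOn g (Icc 0 T)) (hu : ∀ t ∈ Icc 0 T, u t = C + ∫ s in (0 : ℝ)..t, g s)
    {t : ℝ} (ht : t ∈ Icc 0 T) : HasDerivWithinAt u (g t) (Icc 0 T) t := by
  have : Fact (t ∈ Icc 0 T) := ⟨ht⟩
  refine ((intervalIntegral.integral_hasDerivWithinAt_right (s := Icc 0 T) (t := Icc 0 T)
    ?_ ?_ (hg t ht)).const_add C).congr hu (hu t ht)
  · exact (hg.mono (Icc_subset_Icc_right ht.2)).intervalIntegrable_of_Icc ht.1
  · exact hg.stronglyMeasurableAtFilter_nhdsWithin measurableSet_Icc t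

theorem le_mul_exp_of_le_add_integral {u : ℝ → ℝ} {a K T : ℝ} (hK : 0 ≤ K)
    (hcont : ContinuousOn u (Icc 0 T)) (hu : ∀ t ∈ Icc 0 T, u t ≤ a + K * ∫ s in (0 : ℝ)..t, u s) :
    ∀ t ∈ Icc 0 T, u t ≤ a * Real.exp (K * t) := by
  intro t ht
  set v : ℝ → ℝ := fun t => a + ∫ s in (0 : ℝ)..t, K * u s
  have hv : ∀ t ∈ Icc 0 T, HasDerivWithinAt v (K * u t) (Icc 0 T) t := fun t ht =>
    hasDerivWithinAt_Icc_of_eq_add_integral (hcont.const_mul K) (fun _ _ => rfl) ht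
  have huv : ∀ t ∈ Icc 0 T, u t ≤ v t := fun t ht => by
    simpa only [v, intervalIntegral.integral_const_mul] using hu t ht
  have hgronwall := le_gronwallBound_of_liminf_deriv_right_le (f' := fun t => K * u t) (δ := a)
    (K := K) (ε := 0) (fun t ht => (hv t ht).continuousWithinAt)
    (fun t ht r hr => ((hv t (Ico_subset_Icc_self ht)).mono_of_mem_nhdsWithin
      (Icc_mem_nhdsGE_of_mem ht)).liminf_right_slope_le hr)
    (by simp [v]) (fun t ht => by
      simpa using mul_le_mul_of_nonneg_left (huv t (Ico_subset_Icc_self ht)) hK) t ht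
  simpa only [gronwallBound_ε0, sub_zero] using (huv t ht).trans hgronwall

theorem tendsto_floor_mul_add_one_div_nhdsGE (s : ℝ≥0) :
    Tendsto (fun k : ℕ => ((⌊s * (k + 1)⌋₊ : ℝ≥0) + 1) / (k + 1)) atTop (𝓝[≥] s) := by
  have hpos : ∀ k : ℕ, (0 : ℝ≥0) < k + 1 := fun k => by positivity
  have hlow : ∀ k : ℕ, s ≤ ((⌊s * (k + 1)⌋₊ : ℝ≥0) + 1) / (k + 1) := fun k => by
    rw [le_div_iff₀ (hpos k)]
    exact (Nat.lt_floor_add_one _).le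
  have hup : ∀ k : ℕ, ((⌊s * (k + 1)⌋₊ : ℝ≥0) + 1) / (k + 1) ≤ s + 1 / (k + 1) := fun k => by
    rw [div_le_iff₀ (hpos k), add_mul, one_div, inv_mul_cancel₀ (hpos k).ne']
    gcongr
    exact Nat.floor_le zero_le
  refine tendsto_nhdsWithin_iff.2 ⟨?_, Eventually.of_forall hlow⟩
  refine tendsto_of_tendsto_of_tendsto_of_le_of_le tendsto_const_nhds ?_ hlow hup
  simpa using (tendsto_one_div_add_atTop_nhds_zero_nat (𝕜 := ℝ≥0)).const_add s

theorem measurable_uncurry_of_continuousWithinAt_Ici {Ω E : Type*} [MeasurableSpace Ω]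
    [TopologicalSpace E] [TopologicalSpace.PseudoMetrizableSpace E] [MeasurableSpace E]
    [BorelSpace E] {X : ℝ≥0 → Ω → E} (hmeas : ∀ t, Measurable (X t))
    (hcont : ∀ ω t, ContinuousWithinAt (X · ω) (Ici t) t) :
    Measurable (Function.uncurry X) := by
  have hgrid (e : ℕ → ℝ≥0) {φ : ℝ≥0 → ℕ} (hφ : Measurable φ) :
      Measurable fun z : ℝ≥0 × Ω => X (e (φ z.1)) z.2 :=
    (measurable_from_prod_countable_right (f := fun z : ℕ × Ω => X (e z.1) z.2)
      fun n => hmeas (e n)).comp ((hφ.comp measurable_fst).prodMk measurable_snd)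
  refine measurable_of_tendsto_metrizable (fun k : ℕ => hgrid (fun n => (n + 1) / (k + 1))
    (Nat.measurable_floor.comp (measurable_id.mul_const ((k : ℝ≥0) + 1))))
    (tendsto_pi_nhds.2 fun z => ?_)
  exact Tendsto.comp (g := fun t => X t z.2) (hcont z.2 z.1)
    (tendsto_floor_mul_add_one_div_nhdsGE z.1)

/-- `u` is a subsolution of the Hamilton–Jacobi equation `∂u/∂t = H t α u (∂u/∂α)` on
`[0, T] × S`, with one-sided derivatives at end points. The line `α = 0` is a boundary, on which
the inequality is not required. -/
structure IsSubsolution (H : ℝ → ℝ → ℝ → ℝ → ℝ) (T : ℝ) (S : Set ℝ) (u : ℝ → ℝ → ℝ) : Prop where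
  continuousOn : ContinuousOn (Function.uncurry u) (Icc 0 T ×ˢ S)
  deriv_le : ∀ t ∈ Icc 0 T, ∀ α ∈ S, α ≠ 0 → ∃ p d, HasDerivWithinAt (u t) p S α ∧
    HasDerivWithinAt (u · α) d (Icc 0 T) t ∧ d ≤ H t α (u t α) p

/-- `u` is a supersolution of the Hamilton–Jacobi equation `∂u/∂t = H t α u (∂u/∂α)` on
`[0, T] × S`, with the conventions of `IsSubsolution`. -/
structure IsSupersolution (H : ℝ → ℝ → ℝ → ℝ → ℝ) (T : ℝ) (S : Set ℝ) (u : ℝ → ℝ → ℝ) : Prop where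
  continuousOn : ContinuousOn (Function.uncurry u) (Icc 0 T ×ˢ S)
  le_deriv : ∀ t ∈ Icc 0 T, ∀ α ∈ S, α ≠ 0 → ∃ p d, HasDerivWithinAt (u t) p S α ∧
    HasDerivWithinAt (u · α) d (Icc 0 T) t ∧ H t α (u t α) p ≤ d

theorem IsSubsolution.mono {H : ℝ → ℝ → ℝ → ℝ → ℝ} {T : ℝ} {S S' : Set ℝ} {u : ℝ → ℝ → ℝ}
    (hu : IsSubsolution H T S u) (hS : S' ⊆ S) : IsSubsolution H T S' u where
  continuousOn := hu.continuousOn.mono (prod_mono_right hS)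
  deriv_le t ht α hα hα0 :=
    let ⟨p, d, hp, hd, hle⟩ := hu.deriv_le t ht α (hS hα) hα0
    ⟨p, d, hp.mono hS, hd, hle⟩

theorem IsSupersolution.mono {H : ℝ → ℝ → ℝ → ℝ → ℝ} {T : ℝ} {S S' : Set ℝ} {u : ℝ → ℝ → ℝ}
    (hu : IsSupersolution H T S u) (hS : S' ⊆ S) : IsSupersolution H T S' u where
  continuousOn := hu.continuousOn.mono (prod_mono_right hS)
  le_deriv t ht α hα hα0 :=
    let ⟨p, d, hp, hd, hle⟩ := hu.le_deriv t ht α (hS hα) hα0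
    ⟨p, d, hp.mono hS, hd, hle⟩

/- The segment from a maximiser `α` of `u t - v t` back to `0` lies in `S`, so `∂u/∂α - ∂v/∂α` has
the sign of `α` there: no boundary condition is needed on `S` except at `0`. -/
theorem IsSubsolution.le_of_isSupersolution {H : ℝ → ℝ → ℝ → ℝ → ℝ} {T K : ℝ} {S : Set ℝ}
    {u v : ℝ → ℝ → ℝ} (hu : IsSubsolution H T S u) (hv : IsSupersolution H T S v)
    (hS : IsCompact S) (hS0 : StarConvex ℝ 0 S)
    (hHm : ∀ t ∈ Icc 0 T, ∀ α ∈ S, ∀ m m' p, m' ≤ m → H t α m p - H t α m' p ≤ K * (m - m'))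
    (hHp : ∀ t ∈ Icc 0 T, ∀ α ∈ S, ∀ m p p', 0 ≤ α * (p - p') → H t α m p ≤ H t α m p')
    (hinit : ∀ α ∈ S, u 0 α ≤ v 0 α) (hzero : ∀ t ∈ Icc 0 T, u t 0 ≤ v t 0) :
    ∀ t ∈ Icc 0 T, ∀ α ∈ S, u t α ≤ v t α := by
  suffices ∀ t ∈ Icc 0 T, ∀ α ∈ S, u t α - v t α ≤ 0 from
    fun t ht α hα => sub_nonpos.1 (this t ht α hα)
  refine nonpos_of_deriv_le_at_spatial_max (K := K) hS (hu.continuousOn.sub hv.continuousOn)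
    (fun α hα => sub_nonpos.2 (hinit α hα)) fun t ht α hα hpos hmax => ?_
  replace ht := Ioc_subset_Icc_self ht
  have hα0 : α ≠ 0 := by
    rintro rfl
    exact hpos.not_ge (sub_nonpos.2 (hzero t ht))
  obtain ⟨pu, du, hpu, hdu, hule⟩ := hu.deriv_le t ht α hα hα0
  obtain ⟨pv, dv, hpv, hdv, hvle⟩ := hv.le_deriv t ht α hα hα0
  have houtward : (0 - α) * (pu - pv) ≤ 0 :=
    sub_mul_nonpos_of_isLocalMaxOn (hpu.sub hpv) hmax.localize
      (segment_symm ℝ α 0 ▸ hS0.segment_subset hα)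
  refine ⟨du - dv, hdu.sub hdv, ?_⟩
  calc du - dv ≤ H t α (u t α) pu - H t α (v t α) pv := sub_le_sub hule hvle
    _ ≤ H t α (u t α) pv - H t α (v t α) pv :=
      sub_le_sub_right (hHp t ht α hα _ _ _ (by linarith)) _
    _ ≤ K * (u t α - v t α) := hHm t ht α hα _ _ _ (sub_nonneg.1 hpos.le)

/-- The departure term of the fluid equation, in terms of the moments `m = E[e^{αQ}]` and
`p = E[Q e^{αQ}]`: it closes `E[δ(Q, c) e^{αQ}]` by replacing `E[(Q ∧ c) e^{αQ}]` by `p ∧ c m`. -/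
noncomputable def fluidDepartureRate (μ θ : ℝ) (c : ℕ) (m p : ℝ) : ℝ :=
  μ * min p (c * m) + θ * max (p - c * m) 0

/-- The Hamiltonian of the fluid equation: `IsFluidMGF` asks for a solution `M` of
`∂M/∂t = fluidHamiltonian lam μ θ c t α M (∂M/∂α)`. -/
noncomputable def fluidHamiltonian (lam : ℝ → ℝ) (μ θ : ℝ) (c : ℕ) (t α m p : ℝ) : ℝ :=
  lam t * (Real.exp α - 1) * m + (Real.exp (-α) - 1) * fluidDepartureRate μ θ c m p

section Fluid

variable {lam : ℝ → ℝ} {μ θ T α : ℝ} {c : ℕ}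

theorem fluidDepartureRate_eq (μ θ : ℝ) (c : ℕ) (m p : ℝ) :
    fluidDepartureRate μ θ c m p = θ * p + (μ - θ) * min p (c * m) := by
  have hmax : max (p - c * m) 0 = p - min p (c * m) := by grind
  rw [fluidDepartureRate, hmax]
  ring

theorem fluidDepartureRate_mono (hμ : 0 ≤ μ) (hθ : 0 ≤ θ) (c : ℕ) (m : ℝ) :
    Monotone (fluidDepartureRate μ θ c m) := fun p p' h => by
  unfold fluidDepartureRate
  gcongr

theorem abs_fluidDepartureRate_sub_le (μ θ : ℝ) (c : ℕ) (m m' p : ℝ) :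
    |fluidDepartureRate μ θ c m p - fluidDepartureRate μ θ c m' p| ≤ |μ - θ| * c * |m - m'| := by
  rw [fluidDepartureRate_eq, fluidDepartureRate_eq, add_sub_add_left_eq_sub, ← mul_sub, abs_mul,
    mul_assoc]
  gcongr
  calc |min p (c * m) - min p (c * m')| ≤ max |p - p| |c * m - c * m'| :=
        abs_min_sub_min_le_max p (c * m) p (c * m')
    _ = c * |m - m'| := by simp [← mul_sub, abs_mul, mul_nonneg]

theorem exp_neg_sub_one_mul_nonpos {x : ℝ} (h : 0 ≤ α * x) : (Real.exp (-α) - 1) * x ≤ 0 := by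
  rcases lt_trichotomy α 0 with hα | rfl | hα
  · exact mul_nonpos_of_nonneg_of_nonpos (sub_nonneg.2 (Real.one_le_exp (by linarith)))
      (nonpos_of_mul_nonneg_right h hα)
  · simp
  · exact mul_nonpos_of_nonpos_of_nonneg (sub_nonpos.2 (Real.exp_le_one_iff.2 (by linarith)))
      (nonneg_of_mul_nonneg_right h hα)

theorem fluidHamiltonian_le_of_mul_sub_nonneg (hμ : 0 ≤ μ) (hθ : 0 ≤ θ) {t m p p' : ℝ}
    (h : 0 ≤ α * (p - p')) :
    fluidHamiltonian lam μ θ c t α m p ≤ fluidHamiltonian lam μ θ c t α m p' := by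
  have hsign : 0 ≤ α * (fluidDepartureRate μ θ c m p - fluidDepartureRate μ θ c m p') := by
    have hmono := fluidDepartureRate_mono hμ hθ c m
    rcases lt_trichotomy α 0 with hα | rfl | hα
    · exact mul_nonneg_of_nonpos_of_nonpos hα.le
        (sub_nonpos.2 (hmono (sub_nonpos.1 (nonpos_of_mul_nonneg_right h hα))))
    · simp
    · exact mul_nonneg hα.le
        (sub_nonneg.2 (hmono (sub_nonneg.1 (nonneg_of_mul_nonneg_right h hα))))
  unfold fluidHamiltonian
  linarith [exp_neg_sub_one_mul_nonpos hsign]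

theorem fluidHamiltonian_sub_le {t m m' : ℝ} (h : m' ≤ m) (p : ℝ) :
    fluidHamiltonian lam μ θ c t α m p - fluidHamiltonian lam μ θ c t α m' p ≤
      (lam t * (Real.exp α - 1) + |Real.exp (-α) - 1| * (|μ - θ| * c)) * (m - m') := by
  have hlip := abs_fluidDepartureRate_sub_le μ θ c m m' p
  rw [abs_of_nonneg (sub_nonneg.2 h)] at hlip
  have hdep := (le_abs_self _).trans ((abs_mul (Real.exp (-α) - 1) _).le.trans
    (mul_le_mul_of_nonneg_left hlip (abs_nonneg _)))
  unfold fluidHamiltonian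
  linarith

theorem exists_fluidHamiltonian_sub_le {S : Set ℝ} (hlam : ContinuousOn lam (Icc 0 T))
    (hS : IsCompact S) (μ θ : ℝ) (c : ℕ) :
    ∃ K, ∀ t ∈ Icc 0 T, ∀ α ∈ S, ∀ m m' p, m' ≤ m →
      fluidHamiltonian lam μ θ c t α m p - fluidHamiltonian lam μ θ c t α m' p ≤ K * (m - m') := by
  obtain ⟨K, hK⟩ := (isCompact_Icc.prod hS).bddAbove_image (f := fun z : ℝ × ℝ =>
    lam z.1 * (Real.exp z.2 - 1) + |Real.exp (-z.2) - 1| * (|μ - θ| * c))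
    (((hlam.comp continuousOn_fst fun _ hz => hz.1).mul (by fun_prop)).add (by fun_prop))
  refine ⟨K, fun t ht α hα m m' p h => (fluidHamiltonian_sub_le h p).trans ?_⟩
  exact mul_le_mul_of_nonneg_right (hK (mem_image_of_mem _ (mk_mem_prod ht hα))) (sub_nonneg.2 h)

theorem fluid_comparison {S : Set ℝ} {u v : ℝ → ℝ → ℝ} (hμ : 0 ≤ μ) (hθ : 0 ≤ θ)
    (hlam : ContinuousOn lam (Icc 0 T)) (hS : StarConvex ℝ 0 S)
    (hu : IsSubsolution (fluidHamiltonian lam μ θ c) T S u)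
    (hv : IsSupersolution (fluidHamiltonian lam μ θ c) T S v)
    (hinit : ∀ α ∈ S, u 0 α ≤ v 0 α) (hzero : ∀ t ∈ Icc 0 T, u t 0 ≤ v t 0) :
    ∀ t ∈ Icc 0 T, ∀ α ∈ S, u t α ≤ v t α := fun t ht α hα => by
  have hsub : uIcc 0 α ⊆ S := segment_eq_uIcc (0 : ℝ) α ▸ hS.segment_subset hα
  obtain ⟨K, hK⟩ := exists_fluidHamiltonian_sub_le hlam isCompact_uIcc μ θ c
  exact (hu.mono hsub).le_of_isSupersolution (hv.mono hsub) isCompact_uIcc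
    ((convex_uIcc 0 α).starConvex left_mem_uIcc) hK
    (fun _ _ _ _ _ _ _ h => fluidHamiltonian_le_of_mul_sub_nonneg hμ hθ h)
    (fun _ hx => hinit _ (hsub hx)) hzero t ht α right_mem_uIcc

variable {J : Set ℝ} {M : ℝ → ℝ → ℝ}

theorem IsFluidMGF.exists_hasDerivWithinAt (hM : IsFluidMGF lam μ θ c T J M) {t : ℝ}
    (ht : t ∈ Icc 0 T) (hα : α ∈ J) : ∃ p, HasDerivWithinAt (M t) p J α ∧
      HasDerivWithinAt (M · α) (fluidHamiltonian lam μ θ c t α (M t α) p) (Icc 0 T) t := by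
  obtain ⟨p, hp, hd⟩ := hM.pde t ht α hα
  refine ⟨p, hp, hd.congr_deriv ?_⟩
  rw [fluidHamiltonian, fluidDepartureRate_eq]
  ring

theorem IsFluidMGF.isSubsolution (hM : IsFluidMGF lam μ θ c T J M) :
    IsSubsolution (fluidHamiltonian lam μ θ c) T J M where
  continuousOn := hM.cont
  deriv_le _ ht _ hα _ :=
    let ⟨p, hp, hd⟩ := hM.exists_hasDerivWithinAt ht hα
    ⟨p, _, hp, hd, le_rfl⟩

theorem IsFluidMGF.isSupersolution (hM : IsFluidMGF lam μ θ c T J M) :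
    IsSupersolution (fluidHamiltonian lam μ θ c) T J M where
  continuousOn := hM.cont
  le_deriv _ ht _ hα _ :=
    let ⟨p, hp, hd⟩ := hM.exists_hasDerivWithinAt ht hα
    ⟨p, _, hp, hd, le_rfl⟩

theorem IsFluidMGF.apply_zero_eq (hM : IsFluidMGF lam μ θ c T J M) (h0 : (0 : ℝ) ∈ J) :
    ∀ t ∈ Icc 0 T, M t 0 = M 0 0 := by
  have hderiv : ∀ t ∈ Icc 0 T, HasDerivWithinAt (M · 0) 0 (Icc 0 T) t := fun t ht => by
    obtain ⟨p, -, hd⟩ := hM.exists_hasDerivWithinAt ht h0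
    simpa [fluidHamiltonian] using hd
  exact constant_of_has_deriv_right_zero (fun t ht => (hderiv t ht).continuousWithinAt)
    fun t ht => (hderiv t (Ico_subset_Icc_self ht)).mono_of_mem_nhdsWithin
      (Icc_mem_nhdsGE_of_mem ht)

end Fluid

theorem integrable_and_integral_le_of_tendsto {α : Type*} [MeasurableSpace α] {ν : Measure α}
    {f : ℕ → α → ℝ} {F : α → ℝ} {C : ℝ} (hf : ∀ n, Integrable (f n) ν) (h0 : ∀ n, 0 ≤ᵐ[ν] f n)
    (hlim : ∀ᵐ x ∂ν, Tendsto (fun n => f n x) atTop (𝓝 (F x))) (hC : ∀ n, ∫ x, f n x ∂ν ≤ C) :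
    Integrable F ν ∧ ∫ x, F x ∂ν ≤ C := by
  have hF0 : 0 ≤ᵐ[ν] F := by
    filter_upwards [hlim, ae_all_iff.2 h0] with x hx hx0 using ge_of_tendsto' hx hx0
  have hmeas : AEStronglyMeasurable F ν := aestronglyMeasurable_of_tendsto_ae atTop
    (fun n => (hf n).aestronglyMeasurable) hlim
  have hfatou : ∫⁻ x, ENNReal.ofReal (F x) ∂ν ≤ ENNReal.ofReal C := calc
    _ = ∫⁻ x, liminf (fun n => ENNReal.ofReal (f n x)) atTop ∂ν := lintegral_congr_ae <| by
      filter_upwards [hlim] with x hx using (ENNReal.tendsto_ofReal hx).liminf_eq.symm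
    _ ≤ liminf (fun n => ∫⁻ x, ENNReal.ofReal (f n x) ∂ν) atTop :=
      lintegral_liminf_le' fun n => (hf n).aemeasurable.ennreal_ofReal
    _ ≤ ENNReal.ofReal C := liminf_le_of_le (by isBoundedDefault) fun b hb => by
      obtain ⟨n, hn⟩ := hb.exists
      rw [← ofReal_integral_eq_lintegral_ofReal (hf n) (h0 n)] at hn
      exact hn.trans (ENNReal.ofReal_le_ofReal (hC n))
  refine ⟨⟨hmeas, ?_⟩, ?_⟩
  · exact (hasFiniteIntegral_iff_ofReal hF0).2 (hfatou.trans_lt ENNReal.ofReal_lt_top)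
  · rw [integral_eq_lintegral_of_nonneg_ae hF0 hmeas]
    exact ENNReal.toReal_le_of_le_ofReal ((integral_nonneg_of_ae (h0 0)).trans (hC 0)) hfatou

theorem exists_abs_le_of_eventuallyConst {f : ℕ → ℝ} (hf : EventuallyConst f atTop) :
    ∃ C, ∀ n, |f n| ≤ C := by
  obtain ⟨κ, hκ⟩ := eventuallyConst_iff_tendsto.1 hf
  obtain ⟨C, hC⟩ := (hκ.mono_right (pure_le_nhds κ)).abs.bddAbove_range
  exact ⟨C, fun n => hC (mem_range_self n)⟩

theorem natCast_mul_exp_le {α β : ℝ} (h : α < β) (n : ℕ) :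
    n * Real.exp (α * n) ≤ (β - α)⁻¹ * Real.exp (β * n) := by
  rw [inv_mul_eq_div, le_div_iff₀' (sub_pos.2 h), ← mul_assoc]
  calc (β - α) * n * Real.exp (α * n) ≤ Real.exp ((β - α) * n) * Real.exp (α * n) := by
        gcongr
        linarith [Real.add_one_le_exp ((β - α) * n)]
    _ = Real.exp (β * n) := by rw [← Real.exp_add]; ring_nf

theorem abs_sub_le_of_abs_le_exp {f : ℕ → ℝ} {α A : ℝ} (hf : ∀ n, |f n| ≤ A * Real.exp (α * n))
    {k n : ℕ} (h : |(k : ℝ) - n| ≤ 1) :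
    |f k - f n| ≤ 2 * A * Real.exp |α| * Real.exp (α * n) := by
  have hA : 0 ≤ A := by simpa using (abs_nonneg _).trans (hf 0)
  have hshift (j : ℕ) (hj : |(j : ℝ) - n| ≤ 1) :
      |f j| ≤ A * (Real.exp |α| * Real.exp (α * n)) := by
    refine (hf j).trans (mul_le_mul_of_nonneg_left ?_ hA)
    rw [← Real.exp_add, Real.exp_le_exp]
    have : α * (j - n) ≤ |α| := (le_abs_self _).trans
      ((abs_mul α _).trans_le (mul_le_of_le_one_right (abs_nonneg α) hj))
    linarith
  linarith [abs_sub (f k) (f n), hshift k h, hshift n (by simp)]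

section Generator

variable {lam : ℝ → ℝ} {μ θ : ℝ} {c : ℕ} {f : ℕ → ℝ}

theorem erlangDepartureRate_eq (μ θ : ℝ) (c : ℕ) (x : ℝ) :
    erlangDepartureRate μ θ c x = θ * x + (μ - θ) * min x c := by
  simpa [fluidDepartureRate, erlangDepartureRate] using fluidDepartureRate_eq μ θ c 1 x

theorem erlangDepartureRate_nonneg (hμ : 0 ≤ μ) (hθ : 0 ≤ θ) (c n : ℕ) :
    0 ≤ erlangDepartureRate μ θ c n := by
  unfold erlangDepartureRate
  positivity

theorem erlangDepartureRate_le (hμ : 0 ≤ μ) (hθ : 0 ≤ θ) (c n : ℕ) :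
    erlangDepartureRate μ θ c n ≤ (μ + θ) * n := by
  rw [add_mul]
  exact add_le_add (mul_le_mul_of_nonneg_left (min_le_left _ _) hμ)
    (mul_le_mul_of_nonneg_left (max_le (by simp) n.cast_nonneg) hθ)

theorem erlangDepartureRate_zero (μ θ : ℝ) (c : ℕ) : erlangDepartureRate μ θ c 0 = 0 := by
  simp [erlangDepartureRate]

theorem abs_erlangDepartureRate_mul_exp_le (hμ : 0 ≤ μ) (hθ : 0 ≤ θ) {α β : ℝ} (hαβ : α < β)
    (n : ℕ) :
    |erlangDepartureRate μ θ c n * Real.exp (α * n)| ≤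
      (μ + θ) * (β - α)⁻¹ * Real.exp (β * n) := by
  rw [abs_mul, Real.abs_exp, abs_of_nonneg (erlangDepartureRate_nonneg hμ hθ c n)]
  calc erlangDepartureRate μ θ c n * Real.exp (α * n)
      ≤ (μ + θ) * n * Real.exp (α * n) := by
        gcongr
        exact erlangDepartureRate_le hμ hθ c n
    _ = (μ + θ) * (n * Real.exp (α * n)) := mul_assoc _ _ _
    _ ≤ (μ + θ) * ((β - α)⁻¹ * Real.exp (β * n)) :=
        mul_le_mul_of_nonneg_left (natCast_mul_exp_le hαβ n) (add_nonneg hμ hθ)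
    _ = (μ + θ) * (β - α)⁻¹ * Real.exp (β * n) := (mul_assoc _ _ _).symm

theorem abs_erlangGenerator_le (hμ : 0 ≤ μ) (hθ : 0 ≤ θ) {s L α β A : ℝ} (hL : |lam s| ≤ L)
    (hαβ : α < β) (hf : ∀ n, |f n| ≤ A * Real.exp (α * n)) (n : ℕ) :
    |erlangGenerator lam μ θ c s f n| ≤
      2 * A * Real.exp |α| * (L + (μ + θ) * (β - α)⁻¹) * Real.exp (β * n) := by
  have hA : 0 ≤ A := by simpa using (abs_nonneg _).trans (hf 0)
  have hL0 : 0 ≤ L := (abs_nonneg _).trans hL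
  have hup : |f (n + 1) - f n| ≤ 2 * A * Real.exp |α| * Real.exp (α * n) :=
    abs_sub_le_of_abs_le_exp hf (by simp)
  have hdown : |f (n - 1) - f n| ≤ 2 * A * Real.exp |α| * Real.exp (α * n) := by
    refine abs_sub_le_of_abs_le_exp hf ?_
    rcases n with - | n <;> simp
  have hδ := erlangDepartureRate_nonneg hμ hθ c n
  calc |erlangGenerator lam μ θ c s f n|
      ≤ |lam s| * |f (n + 1) - f n| + erlangDepartureRate μ θ c n * |f (n - 1) - f n| := by
        refine (abs_add_le _ _).trans_eq ?_
        rw [abs_mul, abs_mul, abs_of_nonneg hδ]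
    _ ≤ L * (2 * A * Real.exp |α| * Real.exp (α * n)) +
        erlangDepartureRate μ θ c n * (2 * A * Real.exp |α| * Real.exp (α * n)) := by
        gcongr
    _ = 2 * A * Real.exp |α| *
        (L * Real.exp (α * n) + erlangDepartureRate μ θ c n * Real.exp (α * n)) := by
        ring
    _ ≤ 2 * A * Real.exp |α| *
        (L * Real.exp (β * n) + (μ + θ) * (β - α)⁻¹ * Real.exp (β * n)) := by
        refine mul_le_mul_of_nonneg_left (add_le_add (by gcongr) ?_) (by positivity)
        exact (le_abs_self _).trans (abs_erlangDepartureRate_mul_exp_le hμ hθ hαβ n)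
    _ = _ := by ring

theorem erlangGenerator_exp (lam : ℝ → ℝ) (μ θ : ℝ) (c : ℕ) (s α : ℝ) (n : ℕ) :
    erlangGenerator lam μ θ c s (fun k => Real.exp (α * k)) n =
      lam s * (Real.exp α - 1) * Real.exp (α * n) +
        (Real.exp (-α) - 1) * (erlangDepartureRate μ θ c n * Real.exp (α * n)) := by
  have hup : Real.exp (α * (n + 1 : ℕ)) = Real.exp α * Real.exp (α * n) := by
    rw [← Real.exp_add]; push_cast; ring_nf
  rcases n with - | n
  · simp [erlangGenerator, erlangDepartureRate_zero]
  have hdown : Real.exp (α * n) = Real.exp (-α) * Real.exp (α * (n + 1 : ℕ)) := by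
    rw [← Real.exp_add]; push_cast; ring_nf
  simp only [erlangGenerator, add_tsub_cancel_right]
  rw [hup, hdown]
  ring

theorem erlangGenerator_le_of_monotone (hμ : 0 ≤ μ) (hθ : 0 ≤ θ) {s r : ℝ} (hs : 0 ≤ lam s)
    (hmono : Monotone f) {n : ℕ} (hr : f (n + 1) ≤ r * f n) :
    erlangGenerator lam μ θ c s f n ≤ lam s * ((r - 1) * f n) := by
  have hdep : erlangDepartureRate μ θ c n * (f (n - 1) - f n) ≤ 0 :=
    mul_nonpos_of_nonneg_of_nonpos (erlangDepartureRate_nonneg hμ hθ c n)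
      (sub_nonpos.2 (hmono (n.sub_le 1)))
  have harr : lam s * (f (n + 1) - f n) ≤ lam s * ((r - 1) * f n) :=
    mul_le_mul_of_nonneg_left (by linarith) hs
  unfold erlangGenerator
  linarith

theorem erlangGenerator_sub_const (s κ : ℝ) :
    erlangGenerator lam μ θ c s (fun n => f n - κ) = erlangGenerator lam μ θ c s f := by
  funext n
  simp only [erlangGenerator, sub_sub_sub_cancel_right]

theorem eventuallyConst_erlangGenerator (hf : EventuallyConst f atTop) (s : ℝ) :
    EventuallyConst (erlangGenerator lam μ θ c s f) atTop := by
  obtain ⟨N, hN⟩ := eventuallyConst_atTop.1 hf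
  refine eventuallyConst_atTop.2 ⟨N + 1, fun n hn => ?_⟩
  simp [erlangGenerator, hN n (by lia), hN (n + 1) (by lia), hN (n - 1) (by lia),
    hN (N + 1) (by lia), hN (N + 1 + 1) (by lia)]

theorem tendsto_erlangGenerator {ι : Type*} {l : Filter ι} {F : ι → ℕ → ℝ}
    (hF : ∀ n, Tendsto (F · n) l (𝓝 (f n))) (s : ℝ) (n : ℕ) :
    Tendsto (fun i => erlangGenerator lam μ θ c s (F i) n) l
      (𝓝 (erlangGenerator lam μ θ c s f n)) :=
  (((hF _).sub (hF _)).const_mul _).add (((hF _).sub (hF _)).const_mul _)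

end Generator

/-- The mean `E[g(Q(t))]`, with time extended to `ℝ` so that it can be differentiated. -/
noncomputable def meanAt {Ω : Type*} [MeasurableSpace Ω] (P : Measure Ω) (Q : ℝ≥0 → Ω → ℕ)
    (g : ℕ → ℝ) (t : ℝ) : ℝ :=
  ∫ ω, g (Q t.toNNReal ω) ∂P

/-- Dynkin's formula `E[f(Q(t))] = E[f(Q(0))] + ∫₀ᵗ E[G_s(Q(s))] ds`, for `G_s = A_s f` the image of
`f` under the generator; the integrand is required to be integrable. -/
def DynkinFormula {Ω : Type*} [MeasurableSpace Ω] (P : Measure Ω) (Q : ℝ≥0 → Ω → ℕ)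
    (f : ℕ → ℝ) (G : ℝ → ℕ → ℝ) (t : ℝ) : Prop :=
  IntervalIntegrable (fun s => meanAt P Q (G s) s) volume 0 t ∧
    meanAt P Q f t = meanAt P Q f 0 + ∫ s in (0 : ℝ)..t, meanAt P Q (G s) s

/-- The moment generating function `M(t, α) = E[e^{αQ(t)}]` of the queue length, with time extended
to `ℝ` as in `meanAt`. -/
noncomputable def queueMGF {Ω : Type*} [MeasurableSpace Ω] (P : Measure Ω) (Q : ℝ≥0 → Ω → ℕ)
    (t α : ℝ) : ℝ :=
  mgf (fun ω => (Q t.toNNReal ω : ℝ)) P α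

/-- The exponential moment of order `β` of the queue length is bounded on `[0, T]`. -/
def UniformExpMoment {Ω : Type*} [MeasurableSpace Ω] (P : Measure Ω) (Q : ℝ≥0 → Ω → ℕ)
    (T β : ℝ) : Prop :=
  ∃ C, ∀ t ∈ Icc 0 T, Integrable (fun ω => Real.exp (β * Q t.toNNReal ω)) P ∧ queueMGF P Q t β ≤ C

section Dynkin

variable {Ω : Type*} [mΩ : MeasurableSpace Ω] {P : Measure Ω}
  {ℱ : Filtration ℝ≥0 mΩ} {lam : ℝ → ℝ} {μ θ : ℝ} {c : ℕ} {Q : ℝ≥0 → Ω → ℕ} {f g : ℕ → ℝ}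
  {T t α β A : ℝ}

theorem DynkinFormula.continuousOn_meanAt {G : ℝ → ℕ → ℝ}
    (h : ∀ t ∈ Icc 0 T, DynkinFormula P Q f G t) : ContinuousOn (meanAt P Q f) (Icc 0 T) := by
  rcases lt_or_ge T 0 with hT | hT
  · simp [Icc_eq_empty hT.not_ge]
  have hprim := intervalIntegral.continuousOn_primitive_interval' (h T (right_mem_Icc.2 hT)).1
    left_mem_uIcc
  rw [uIcc_of_le hT] at hprim
  exact (continuousOn_const.add hprim).congr fun t ht => (h t ht).2

theorem DynkinFormula.of_tendsto {F : ℕ → ℕ → ℝ} {GF : ℕ → ℝ → ℕ → ℝ} {G : ℝ → ℕ → ℝ} {B : ℝ}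
    (ht : 0 ≤ t) (h : ∀ N, DynkinFormula P Q (F N) (GF N) t)
    (hF0 : Tendsto (fun N => meanAt P Q (F N) 0) atTop (𝓝 (meanAt P Q f 0)))
    (hFt : Tendsto (fun N => meanAt P Q (F N) t) atTop (𝓝 (meanAt P Q f t)))
    (hG : ∀ s ∈ Ioc 0 t,
      Tendsto (fun N => meanAt P Q (GF N s) s) atTop (𝓝 (meanAt P Q (G s) s)))
    (hB : ∀ N, ∀ s ∈ Ioc 0 t, |meanAt P Q (GF N s) s| ≤ B) : DynkinFormula P Q f G t := by
  have hmeas (N : ℕ) := (h N).1.aestronglyMeasurable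
  have hlim : ∀ᵐ s ∂volume.restrict (Ioc 0 t),
      Tendsto (fun N => meanAt P Q (GF N s) s) atTop (𝓝 (meanAt P Q (G s) s)) :=
    ae_restrict_of_forall_mem measurableSet_Ioc hG
  have hle : ∀ᵐ s ∂volume.restrict (Ioc 0 t), |meanAt P Q (G s) s| ≤ B :=
    ae_restrict_of_forall_mem measurableSet_Ioc fun s hs =>
      le_of_tendsto' (hG s hs).abs fun N => hB N s hs
  refine ⟨(intervalIntegrable_iff_integrableOn_Ioc_of_le ht).2 (Integrable.of_bound
    (aestronglyMeasurable_of_tendsto_ae atTop hmeas hlim) B hle), ?_⟩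
  refine tendsto_nhds_unique hFt ((hF0.add ?_).congr fun N => (h N).2.symm)
  simp only [intervalIntegral.integral_of_le ht]
  exact tendsto_integral_of_dominated_convergence (fun _ => B) hmeas (integrable_const B)
    (fun N => ae_restrict_of_forall_mem measurableSet_Ioc (hB N)) hlim

theorem abs_meanAt_le {C : ℝ}
    (hC : ∀ t ∈ Icc 0 T, Integrable (fun ω => Real.exp (β * Q t.toNNReal ω)) P ∧
      queueMGF P Q t β ≤ C) (hg : ∀ n, |g n| ≤ A * Real.exp (β * n)) (ht : t ∈ Icc 0 T) :
    |meanAt P Q g t| ≤ A * C :=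
  have hA : 0 ≤ A := by simpa using (abs_nonneg _).trans (hg 0)
  calc |meanAt P Q g t| ≤ ∫ ω, A * Real.exp (β * Q t.toNNReal ω) ∂P :=
        norm_integral_le_of_norm_le (f := fun ω => g (Q t.toNNReal ω)) ((hC t ht).1.const_mul A)
          (Eventually.of_forall fun _ => hg _)
    _ = A * queueMGF P Q t β := integral_const_mul _ _
    _ ≤ A * C := mul_le_mul_of_nonneg_left (hC t ht).2 hA

namespace IsErlangA

theorem measurable (hQ : IsErlangA P ℱ lam μ θ c Q) (t : ℝ≥0) : Measurable (Q t) :=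
  (hQ.adapted t).mono (ℱ.le t) le_rfl

theorem measurable_uncurry (hQ : IsErlangA P ℱ lam μ θ c Q) :
    Measurable fun z : Ω × ℝ => Q z.2.toNNReal z.1 :=
  (measurable_uncurry_of_continuousWithinAt_Ici hQ.measurable hQ.rightCont).comp
    ((measurable_real_toNNReal.comp measurable_snd).prodMk measurable_fst)

theorem aestronglyMeasurable (hQ : IsErlangA P ℱ lam μ θ c Q) (g : ℕ → ℝ) (t : ℝ≥0) :
    AEStronglyMeasurable (fun ω => g (Q t ω)) P :=
  ((measurable_from_nat (f := g)).comp (hQ.measurable t)).aestronglyMeasurable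

theorem integrable_of_abs_le_exp (hQ : IsErlangA P ℱ lam μ θ c Q)
    (hβ : UniformExpMoment P Q T β) (hg : ∀ n, |g n| ≤ A * Real.exp (β * n)) (ht : t ∈ Icc 0 T) :
    Integrable (fun ω => g (Q t.toNNReal ω)) P :=
  have ⟨_, hC⟩ := hβ
  ((hC t ht).1.const_mul A).mono' (hQ.aestronglyMeasurable g _) (Eventually.of_forall fun _ => hg _)

theorem tendsto_meanAt (hQ : IsErlangA P ℱ lam μ θ c Q) {G : ℕ → ℕ → ℝ}
    (hβ : UniformExpMoment P Q T β) (hG : ∀ N n, |G N n| ≤ A * Real.exp (β * n))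
    (hlim : ∀ n, Tendsto (G · n) atTop (𝓝 (g n))) (ht : t ∈ Icc 0 T) :
    Tendsto (fun N => meanAt P Q (G N) t) atTop (𝓝 (meanAt P Q g t)) :=
  have ⟨_, hC⟩ := hβ
  tendsto_integral_of_dominated_convergence _ (fun N => hQ.aestronglyMeasurable (G N) _)
    ((hC t ht).1.const_mul A) (fun N => Eventually.of_forall fun _ => hG N _)
    (Eventually.of_forall fun _ => hlim _)

theorem meanAt_erlangGenerator_exp (hQ : IsErlangA P ℱ lam μ θ c Q) (hμ : 0 ≤ μ) (hθ : 0 ≤ θ)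
    (hβ : UniformExpMoment P Q T β) (hαβ : α < β) (ht : t ∈ Icc 0 T) :
    meanAt P Q (erlangGenerator lam μ θ c t fun n => Real.exp (α * n)) t =
      lam t * (Real.exp α - 1) * queueMGF P Q t α + (Real.exp (-α) - 1) *
        meanAt P Q (fun n => erlangDepartureRate μ θ c n * Real.exp (α * n)) t := by
  have hexp : Integrable (fun ω => Real.exp (α * Q t.toNNReal ω)) P :=
    hQ.integrable_of_abs_le_exp (g := fun n => Real.exp (α * n)) (A := 1) hβ
      (fun n => by rw [Real.abs_exp, one_mul]; gcongr) ht
  have hdep := hQ.integrable_of_abs_le_exp hβ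
    (abs_erlangDepartureRate_mul_exp_le (c := c) hμ hθ hαβ) ht
  simp only [meanAt, erlangGenerator_exp]
  rw [integral_add (hexp.const_mul _) (hdep.const_mul _), integral_const_mul, integral_const_mul]
  rfl

variable [IsProbabilityMeasure P]

theorem integrable_of_eventuallyConst (hQ : IsErlangA P ℱ lam μ θ c Q)
    (hf : EventuallyConst f atTop) (t : ℝ≥0) : Integrable (fun ω => f (Q t ω)) P := by
  obtain ⟨C, hC⟩ := exists_abs_le_of_eventuallyConst hf
  exact Integrable.of_bound (hQ.aestronglyMeasurable f t) C (Eventually.of_forall fun _ => hC _)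

theorem integrable_generator_prod (hQ : IsErlangA P ℱ lam μ θ c Q)
    (hlam : ContinuousOn lam (Icc 0 t)) (hf : EventuallyConst f atTop) :
    Integrable (fun z : Ω × ℝ => erlangGenerator lam μ θ c z.2 f (Q z.2.toNNReal z.1))
      (P.prod (volume.restrict (Ioc 0 t))) := by
  obtain ⟨N, hN⟩ := eventuallyConst_atTop.1 hf
  obtain ⟨a, ha⟩ : ∃ a, ∀ n, |f (n + 1) - f n| ≤ a :=
    exists_abs_le_of_eventuallyConst (eventuallyConst_atTop.2
      ⟨N, fun n hn => by simp [hN n hn, hN (n + 1) (by lia), hN (N + 1) (by lia)]⟩)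
  obtain ⟨b, hb⟩ : ∃ b, ∀ n : ℕ, |erlangDepartureRate μ θ c n * (f (n - 1) - f n)| ≤ b :=
    exists_abs_le_of_eventuallyConst (eventuallyConst_atTop.2
      ⟨N + 1, fun n hn => by simp [hN n (by lia), hN (n - 1) (by lia), hN (N + 1) (by lia)]⟩)
  have hmeas (g : ℕ → ℝ) : AEStronglyMeasurable (fun z : Ω × ℝ => g (Q z.2.toNNReal z.1))
      (P.prod (volume.restrict (Ioc 0 t))) :=
    ((measurable_from_nat (f := g)).comp hQ.measurable_uncurry).aestronglyMeasurable
  have hlam_int : Integrable lam (volume.restrict (Ioc 0 t)) :=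
    hlam.integrableOn_Icc.mono_set Ioc_subset_Icc_self
  exact ((hlam_int.comp_snd P).mul_bdd (hmeas fun n => f (n + 1) - f n)
    (Eventually.of_forall fun _ => ha _)).add
    (Integrable.of_bound (hmeas fun n => erlangDepartureRate μ θ c n * (f (n - 1) - f n)) b
      (Eventually.of_forall fun _ => hb _))

/- Subtracting the limit of `f` changes neither the increments nor `A_s f`, and makes the support
finite. -/
theorem integral_increment_eq_zero (hQ : IsErlangA P ℱ lam μ θ c Q)
    (hf : EventuallyConst f atTop) (t : ℝ≥0) :
    ∫ ω, (f (Q t ω) - f (Q 0 ω) -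
      ∫ s in (0 : ℝ)..t, erlangGenerator lam μ θ c s f (Q s.toNNReal ω)) ∂P = 0 := by
  obtain ⟨N, hN⟩ := eventuallyConst_atTop.1 hf
  have hsupp : (Function.support fun n => f n - f N).Finite :=
    (finite_Iio N).subset fun n hn => not_le.1 fun h => hn (sub_eq_zero.2 (hN n h))
  have hmart := (hQ.martingale _ hsupp).setIntegral_eq (zero_le (a := t)) MeasurableSet.univ
  simpa [erlangGenerator_sub_const] using hmart.symm

theorem dynkinFormula_of_eventuallyConst (hQ : IsErlangA P ℱ lam μ θ c Q)
    (hlam : ContinuousOn lam (Icc 0 t)) (ht : 0 ≤ t) (hf : EventuallyConst f atTop) :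
    DynkinFormula P Q f (fun s => erlangGenerator lam μ θ c s f) t := by
  have hprod := hQ.integrable_generator_prod hlam hf
  have hswap : ∫ ω, (∫ s in (0 : ℝ)..t, erlangGenerator lam μ θ c s f (Q s.toNNReal ω)) ∂P =
      ∫ s in (0 : ℝ)..t, meanAt P Q (erlangGenerator lam μ θ c s f) s := by
    simp only [intervalIntegral.integral_of_le ht]
    exact integral_integral_swap
      (f := fun ω s => erlangGenerator lam μ θ c s f (Q s.toNNReal ω)) hprod
  have hdrift : Integrable
      (fun ω => ∫ s in (0 : ℝ)..t, erlangGenerator lam μ θ c s f (Q s.toNNReal ω)) P := by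
    simpa only [intervalIntegral.integral_of_le ht] using hprod.integral_prod_left
  have hint := hQ.integrable_of_eventuallyConst hf
  have hmart := hQ.integral_increment_eq_zero hf t.toNNReal
  rw [Real.coe_toNNReal t ht, integral_sub (f := fun ω => f (Q t.toNNReal ω) - f (Q 0 ω))
    ((hint _).sub (hint _)) hdrift, integral_sub (hint _) (hint _), hswap] at hmart
  refine ⟨(intervalIntegrable_iff_integrableOn_Ioc_of_le ht).2 hprod.integral_prod_right, ?_⟩
  rw [meanAt, meanAt, Real.toNNReal_zero]
  linarith

theorem meanAt_le_mul_exp (hQ : IsErlangA P ℱ lam μ θ c Q) (hμ : 0 ≤ μ) (hθ : 0 ≤ θ)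
    (hlam : ContinuousOn lam (Icc 0 T)) {L r : ℝ} (hlam0 : ∀ t ∈ Icc 0 T, 0 ≤ lam t)
    (hL : ∀ t ∈ Icc 0 T, lam t ≤ L) (hf : EventuallyConst f atTop) (hf0 : ∀ n, 0 ≤ f n)
    (hmono : Monotone f) (hr1 : 1 ≤ r) (hr : ∀ n, f (n + 1) ≤ r * f n) (ht : t ∈ Icc 0 T) :
    meanAt P Q f t ≤ meanAt P Q f 0 * Real.exp (L * (r - 1) * t) := by
  have hL0 : 0 ≤ L := (hlam0 t ht).trans (hL t ht)
  have hdynkin : ∀ t ∈ Icc 0 T,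
      DynkinFormula P Q f (fun s => erlangGenerator lam μ θ c s f) t := fun t ht =>
    hQ.dynkinFormula_of_eventuallyConst (hlam.mono (Icc_subset_Icc_right ht.2)) ht.1 hf
  have hcont := DynkinFormula.continuousOn_meanAt hdynkin
  refine le_mul_exp_of_le_add_integral (mul_nonneg hL0 (sub_nonneg.2 hr1)) hcont
    (fun t ht => ?_) t ht
  rw [(hdynkin t ht).2, ← intervalIntegral.integral_const_mul]
  gcongr
  refine intervalIntegral.integral_mono_on ht.1 (hdynkin t ht).1
    ((hcont.mono (Icc_subset_Icc_right ht.2)).intervalIntegrable_of_Icc ht.1 |>.const_mul _)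
    fun s hs => ?_
  replace hs : s ∈ Icc 0 T := ⟨hs.1, hs.2.trans ht.2⟩
  rw [meanAt, meanAt, ← integral_const_mul]
  refine integral_mono (hQ.integrable_of_eventuallyConst (eventuallyConst_erlangGenerator hf s) _)
    ((hQ.integrable_of_eventuallyConst hf _).const_mul _) fun ω => ?_
  calc erlangGenerator lam μ θ c s f (Q s.toNNReal ω)
      ≤ lam s * ((r - 1) * f (Q s.toNNReal ω)) :=
        erlangGenerator_le_of_monotone hμ hθ (hlam0 s hs) hmono (hr _)
    _ ≤ L * ((r - 1) * f (Q s.toNNReal ω)) :=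
        mul_le_mul_of_nonneg_right (hL s hs) (mul_nonneg (sub_nonneg.2 hr1) (hf0 _))
    _ = L * (r - 1) * f (Q s.toNNReal ω) := (mul_assoc _ _ _).symm

/- The truncations `exp (α (n ∧ N))` are eventually constant, and their means satisfy a Grönwall
bound uniform in `N`. -/
theorem integrable_exp_and_mgf_le (hQ : IsErlangA P ℱ lam μ θ c Q) (hμ : 0 ≤ μ) (hθ : 0 ≤ θ)
    (hlam : ContinuousOn lam (Icc 0 T)) {L : ℝ} (hlam0 : ∀ t ∈ Icc 0 T, 0 ≤ lam t)
    (hL : ∀ t ∈ Icc 0 T, lam t ≤ L) (hα : 0 ≤ α)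
    (h0 : Integrable (fun ω => Real.exp (α * Q 0 ω)) P) (ht : t ∈ Icc 0 T) :
    Integrable (fun ω => Real.exp (α * Q t.toNNReal ω)) P ∧
      queueMGF P Q t α ≤ queueMGF P Q 0 α * Real.exp (L * (Real.exp α - 1) * t) := by
  set F : ℕ → ℕ → ℝ := fun N n => Real.exp (α * (min n N : ℕ))
  have hconst (N : ℕ) : EventuallyConst (F N) atTop :=
    eventuallyConst_atTop.2 ⟨N, fun n hn => by simp [F, hn]⟩
  have hmono (N : ℕ) : Monotone (F N) := fun m n hmn => by simp only [F]; gcongr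
  have hstep (N n : ℕ) : F N (n + 1) ≤ Real.exp α * F N n := by
    have hmin : ((min (n + 1) N : ℕ) : ℝ) ≤ 1 + (min n N : ℕ) := by
      exact_mod_cast (by lia : min (n + 1) N ≤ 1 + min n N)
    rw [← Real.exp_add, Real.exp_le_exp]
    linarith [mul_le_mul_of_nonneg_left hmin hα]
  have hlim (n : ℕ) : Tendsto (F · n) atTop (𝓝 (Real.exp (α * n))) :=
    tendsto_const_nhds.congr' <| (eventually_ge_atTop n).mono fun N hN => by simp [F, hN]
  have hinit (N : ℕ) : meanAt P Q (F N) 0 ≤ queueMGF P Q 0 α := by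
    refine integral_mono (hQ.integrable_of_eventuallyConst (hconst N) _)
      (by simpa only [Real.toNNReal_zero] using h0) fun ω => ?_
    simp only [F]
    gcongr
    exact min_le_left _ _
  refine integrable_and_integral_le_of_tendsto (f := fun N ω => F N (Q t.toNNReal ω))
    (fun N => hQ.integrable_of_eventuallyConst (hconst N) _)
    (fun N => Eventually.of_forall fun _ => (Real.exp_pos _).le)
    (Eventually.of_forall fun _ => hlim _) fun N => ?_
  calc meanAt P Q (F N) t ≤ meanAt P Q (F N) 0 * Real.exp (L * (Real.exp α - 1) * t) :=
        hQ.meanAt_le_mul_exp hμ hθ hlam hlam0 hL (hconst N) (fun _ => (Real.exp_pos _).le)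
          (hmono N) (Real.one_le_exp hα) (hstep N) ht
    _ ≤ queueMGF P Q 0 α * Real.exp (L * (Real.exp α - 1) * t) :=
        mul_le_mul_of_nonneg_right (hinit N) (Real.exp_pos _).le

theorem uniformExpMoment (hQ : IsErlangA P ℱ lam μ θ c Q) (hμ : 0 ≤ μ) (hθ : 0 ≤ θ)
    (hlam : ContinuousOn lam (Icc 0 T)) (hlam0 : ∀ t ∈ Icc 0 T, 0 ≤ lam t) (hα : 0 ≤ α)
    (h0 : Integrable (fun ω => Real.exp (α * Q 0 ω)) P) : UniformExpMoment P Q T α := by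
  obtain ⟨L, hL⟩ := isCompact_Icc.exists_bound_of_continuousOn hlam
  refine ⟨queueMGF P Q 0 α * Real.exp (L * (Real.exp α - 1) * T), fun t ht => ?_⟩
  have hL0 : 0 ≤ L := (norm_nonneg _).trans (hL t ht)
  obtain ⟨hint, hle⟩ := hQ.integrable_exp_and_mgf_le hμ hθ hlam hlam0
    (fun t ht => (le_abs_self _).trans (hL t ht)) hα h0 ht
  refine ⟨hint, hle.trans (mul_le_mul_of_nonneg_left (Real.exp_le_exp.2 ?_) mgf_nonneg)⟩
  exact mul_le_mul_of_nonneg_left ht.2 (mul_nonneg hL0 (sub_nonneg.2 (Real.one_le_exp hα)))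

/- Truncate `f` and pass to the limit by dominated convergence. -/
theorem dynkinFormula (hQ : IsErlangA P ℱ lam μ θ c Q) (hμ : 0 ≤ μ) (hθ : 0 ≤ θ)
    (hlam : ContinuousOn lam (Icc 0 T)) (hβ : UniformExpMoment P Q T β) (hαβ : α < β)
    (hf : ∀ n, |f n| ≤ A * Real.exp (α * n)) (ht : t ∈ Icc 0 T) :
    DynkinFormula P Q f (fun s => erlangGenerator lam μ θ c s f) t := by
  have hA : 0 ≤ A := by simpa using (abs_nonneg _).trans (hf 0)
  set F : ℕ → ℕ → ℝ := fun N => (Iio N).indicator f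
  have hFα (N n : ℕ) : |F N n| ≤ A * Real.exp (α * n) :=
    (norm_indicator_le_norm_self f n).trans (hf n)
  have hFlim (n : ℕ) : Tendsto (F · n) atTop (𝓝 (f n)) :=
    tendsto_const_nhds.congr' <| (eventually_gt_atTop n).mono fun N hN => by simp [F, hN]
  have hfβ (N n : ℕ) : |F N n| ≤ A * Real.exp (β * n) := (hFα N n).trans (by gcongr)
  have hconst (N : ℕ) : EventuallyConst (F N) atTop :=
    eventuallyConst_atTop.2 ⟨N, fun n hn => by simp [F, hn]⟩
  obtain ⟨L, hL⟩ := isCompact_Icc.exists_bound_of_continuousOn hlam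
  have hgen (N : ℕ) {s : ℝ} (hs : s ∈ Icc 0 T) := abs_erlangGenerator_le (c := c) hμ hθ (hL s hs)
    hαβ (hFα N)
  have hst {s : ℝ} (hs : s ∈ Ioc 0 t) : s ∈ Icc 0 T := ⟨hs.1.le, hs.2.trans ht.2⟩
  obtain ⟨C, hC⟩ := id hβ
  exact DynkinFormula.of_tendsto ht.1
    (fun N => hQ.dynkinFormula_of_eventuallyConst
      (hlam.mono (Icc_subset_Icc_right ht.2)) ht.1 (hconst N))
    (hQ.tendsto_meanAt hβ hfβ hFlim ⟨le_rfl, ht.1.trans ht.2⟩) (hQ.tendsto_meanAt hβ hfβ hFlim ht)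
    (fun s hs => hQ.tendsto_meanAt hβ (fun N => hgen N (hst hs)) (tendsto_erlangGenerator hFlim s)
      (hst hs))
    fun N s hs => abs_meanAt_le hC (hgen N (hst hs)) (hst hs)

theorem continuousOn_meanAt (hQ : IsErlangA P ℱ lam μ θ c Q) (hμ : 0 ≤ μ) (hθ : 0 ≤ θ)
    (hlam : ContinuousOn lam (Icc 0 T)) (hβ : UniformExpMoment P Q T β) (hαβ : α < β)
    (hf : ∀ n, |f n| ≤ A * Real.exp (α * n)) : ContinuousOn (meanAt P Q f) (Icc 0 T) :=
  DynkinFormula.continuousOn_meanAt fun _ ht => hQ.dynkinFormula hμ hθ hlam hβ hαβ hf ht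

theorem hasDerivWithinAt_queueMGF (hQ : IsErlangA P ℱ lam μ θ c Q) (hμ : 0 ≤ μ) (hθ : 0 ≤ θ)
    (hlam : ContinuousOn lam (Icc 0 T)) (hβ : UniformExpMoment P Q T β) (hαβ : α < β)
    (ht : t ∈ Icc 0 T) :
    HasDerivWithinAt (queueMGF P Q · α)
      (lam t * (Real.exp α - 1) * queueMGF P Q t α + (Real.exp (-α) - 1) *
        meanAt P Q (fun n => erlangDepartureRate μ θ c n * Real.exp (α * n)) t) (Icc 0 T) t := by
  obtain ⟨γ, hαγ, hγβ⟩ := exists_between hαβ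
  have hexp (n : ℕ) : |Real.exp (α * n)| ≤ 1 * Real.exp (α * n) := by simp
  have hcont_mgf : ContinuousOn (queueMGF P Q · α) (Icc 0 T) :=
    hQ.continuousOn_meanAt hμ hθ hlam hβ hαβ hexp
  have hcont_dep := hQ.continuousOn_meanAt hμ hθ hlam hβ hγβ
    (abs_erlangDepartureRate_mul_exp_le (c := c) hμ hθ hαγ)
  refine hasDerivWithinAt_Icc_of_eq_add_integral (C := queueMGF P Q 0 α)
    (((hlam.mul continuousOn_const).mul hcont_mgf).add (continuousOn_const.mul hcont_dep))
    (fun s hs => ?_) ht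
  refine (hQ.dynkinFormula hμ hθ hlam hβ hαβ hexp hs).2.trans
    (congrArg _ (intervalIntegral.integral_congr fun r hr => ?_))
  rw [uIcc_of_le hs.1] at hr
  exact hQ.meanAt_erlangGenerator_exp hμ hθ hβ hαβ ⟨hr.1, hr.2.trans hs.2⟩

end IsErlangA

end Dynkin

section ExpMoment

variable {Ω : Type*} [MeasurableSpace Ω] {P : Measure Ω} {X : Ω → ℝ} {α β : ℝ}

theorem integrable_exp_mul_of_le_of_nonneg (hX : AEMeasurable X P) (hX0 : 0 ≤ᵐ[P] X)
    (hβ : Integrable (fun ω => Real.exp (β * X ω)) P) (hαβ : α ≤ β) :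
    Integrable (fun ω => Real.exp (α * X ω)) P :=
  hβ.mono' (Real.measurable_exp.comp_aemeasurable (hX.const_mul α)).aestronglyMeasurable
    (by
      filter_upwards [hX0] with ω hω
      rw [Real.norm_eq_abs, Real.abs_exp, Real.exp_le_exp]
      exact mul_le_mul_of_nonneg_right hαβ hω)

theorem monotoneOn_mgf_of_nonneg (hX : AEMeasurable X P) (hX0 : 0 ≤ᵐ[P] X)
    (hβ : Integrable (fun ω => Real.exp (β * X ω)) P) : MonotoneOn (mgf X P) (Iic β) :=
  fun _ ha _ hb hab => integral_mono_ae (integrable_exp_mul_of_le_of_nonneg hX hX0 hβ ha)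
    (integrable_exp_mul_of_le_of_nonneg hX hX0 hβ hb)
    (by filter_upwards [hX0] with ω hω using
      Real.exp_le_exp.2 (mul_le_mul_of_nonneg_right hab hω))

theorem continuousOn_mgf_of_nonneg (hX : AEMeasurable X P) (hX0 : 0 ≤ᵐ[P] X)
    (hβ : Integrable (fun ω => Real.exp (β * X ω)) P) : ContinuousOn (mgf X P) (Iic β) :=
  continuousOn_of_dominated
    (fun _ ha => (integrable_exp_mul_of_le_of_nonneg hX hX0 hβ ha).aestronglyMeasurable)
    (fun a ha => by
      filter_upwards [hX0] with ω hω
      rw [Real.norm_eq_abs, Real.abs_exp, Real.exp_le_exp]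
      exact mul_le_mul_of_nonneg_right ha hω) hβ
    (Eventually.of_forall fun ω => by fun_prop)

theorem Iio_subset_interior_integrableExpSet (hX : AEMeasurable X P) (hX0 : 0 ≤ᵐ[P] X)
    (hβ : Integrable (fun ω => Real.exp (β * X ω)) P) : Iio β ⊆ interior (integrableExpSet X P) :=
  interior_maximal (fun _ ha => integrable_exp_mul_of_le_of_nonneg hX hX0 hβ (le_of_lt ha))
    isOpen_Iio

end ExpMoment

section Comparison

variable {Ω : Type*} [mΩ : MeasurableSpace Ω] {P : Measure Ω}
  {ℱ : Filtration ℝ≥0 mΩ} {lam : ℝ → ℝ} {μ θ : ℝ} {c : ℕ} {Q : ℝ≥0 → Ω → ℕ}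
  {T t α β : ℝ} {S J : Set ℝ}

namespace IsErlangA

theorem aemeasurable_cast (hQ : IsErlangA P ℱ lam μ θ c Q) (t : ℝ≥0) :
    AEMeasurable (fun ω => (Q t ω : ℝ)) P :=
  (measurable_from_nat.comp (hQ.measurable t)).aemeasurable

theorem integrable_exp (hQ : IsErlangA P ℱ lam μ θ c Q) (hβ : UniformExpMoment P Q T β)
    (hαβ : α ≤ β) (ht : t ∈ Icc 0 T) : Integrable (fun ω => Real.exp (α * Q t.toNNReal ω)) P :=
  have ⟨_, hC⟩ := hβ
  integrable_exp_mul_of_le_of_nonneg (hQ.aemeasurable_cast _)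
    (ae_of_all P fun _ => Nat.cast_nonneg _) (hC t ht).1 hαβ

theorem continuousOn_queueMGF (hQ : IsErlangA P ℱ lam μ θ c Q) (hβ : UniformExpMoment P Q T β)
    (ht : t ∈ Icc 0 T) : ContinuousOn (queueMGF P Q t) (Iic β) :=
  continuousOn_mgf_of_nonneg (hQ.aemeasurable_cast _) (ae_of_all P fun _ => Nat.cast_nonneg _)
    (hQ.integrable_exp hβ le_rfl ht)

theorem hasDerivAt_queueMGF (hQ : IsErlangA P ℱ lam μ θ c Q) (hβ : UniformExpMoment P Q T β)
    (hαβ : α < β) (ht : t ∈ Icc 0 T) :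
    HasDerivAt (queueMGF P Q t) (meanAt P Q (fun n => n * Real.exp (α * n)) t) α :=
  hasDerivAt_mgf (Iio_subset_interior_integrableExpSet (hQ.aemeasurable_cast _)
    (ae_of_all P fun _ => Nat.cast_nonneg _) (hQ.integrable_exp hβ le_rfl ht) hαβ)

theorem integrable_natCast_mul_exp (hQ : IsErlangA P ℱ lam μ θ c Q)
    (hβ : UniformExpMoment P Q T β) (hαβ : α < β) (ht : t ∈ Icc 0 T) :
    Integrable (fun ω => Q t.toNNReal ω * Real.exp (α * Q t.toNNReal ω)) P :=
  hQ.integrable_of_abs_le_exp (g := fun n => n * Real.exp (α * n)) hβ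
    (fun n => (abs_of_nonneg (by positivity)).trans_le (natCast_mul_exp_le hαβ n)) ht

theorem integrable_min_mul_exp (hQ : IsErlangA P ℱ lam μ θ c Q)
    (hβ : UniformExpMoment P Q T β) (hαβ : α < β) (ht : t ∈ Icc 0 T) :
    Integrable (fun ω => min (Q t.toNNReal ω : ℝ) c * Real.exp (α * Q t.toNNReal ω)) P :=
  hQ.integrable_of_abs_le_exp (g := fun n => min (n : ℝ) c * Real.exp (α * n)) hβ
    (fun n => (abs_of_nonneg (by positivity)).trans_le
      ((mul_le_mul_of_nonneg_right (min_le_left _ _) (Real.exp_pos _).le).trans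
        (natCast_mul_exp_le hαβ n))) ht

theorem meanAt_min_mul_exp_le (hQ : IsErlangA P ℱ lam μ θ c Q) (hβ : UniformExpMoment P Q T β)
    (hαβ : α < β) (ht : t ∈ Icc 0 T) :
    meanAt P Q (fun n => min (n : ℝ) c * Real.exp (α * n)) t ≤
      min (meanAt P Q (fun n => n * Real.exp (α * n)) t) (c * queueMGF P Q t α) := by
  have hmin := hQ.integrable_min_mul_exp hβ hαβ ht
  refine le_min (integral_mono hmin (hQ.integrable_natCast_mul_exp hβ hαβ ht) fun ω => ?_) ?_
  · exact mul_le_mul_of_nonneg_right (min_le_left _ _) (Real.exp_pos _).le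
  · rw [queueMGF, mgf, ← integral_const_mul]
    exact integral_mono hmin ((hQ.integrable_exp hβ hαβ.le ht).const_mul _) fun ω =>
      mul_le_mul_of_nonneg_right (min_le_right _ _) (Real.exp_pos _).le

theorem meanAt_erlangDepartureRate_mul_exp (hQ : IsErlangA P ℱ lam μ θ c Q)
    (hβ : UniformExpMoment P Q T β) (hαβ : α < β) (ht : t ∈ Icc 0 T) :
    meanAt P Q (fun n => erlangDepartureRate μ θ c n * Real.exp (α * n)) t =
      θ * meanAt P Q (fun n => n * Real.exp (α * n)) t +
        (μ - θ) * meanAt P Q (fun n => min (n : ℝ) c * Real.exp (α * n)) t := by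
  simp only [meanAt, erlangDepartureRate_eq, add_mul, mul_assoc]
  rw [integral_add ((hQ.integrable_natCast_mul_exp hβ hαβ ht).const_mul _)
    ((hQ.integrable_min_mul_exp hβ hαβ ht).const_mul _), integral_const_mul, integral_const_mul]

variable [IsProbabilityMeasure P]

/- `gap` is the Jensen gap `E[X] ∧ E[Y] - E[X ∧ Y]` for `X = Q e^{αQ}` and `Y = c e^{αQ}`: the error
made by the fluid closure of the departure term. -/
theorem exists_queueMGF_deriv_eq_sub_gap (hQ : IsErlangA P ℱ lam μ θ c Q) (hμ : 0 ≤ μ)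
    (hθ : 0 ≤ θ) (hlam : ContinuousOn lam (Icc 0 T)) (hβ : UniformExpMoment P Q T β) (hαβ : α < β)
    (ht : t ∈ Icc 0 T) : ∃ p gap, 0 ≤ gap ∧ HasDerivAt (queueMGF P Q t) p α ∧
      HasDerivWithinAt (queueMGF P Q · α) (fluidHamiltonian lam μ θ c t α (queueMGF P Q t α) p -
        (Real.exp (-α) - 1) * ((μ - θ) * gap)) (Icc 0 T) t := by
  refine ⟨_, _, sub_nonneg.2 (hQ.meanAt_min_mul_exp_le hβ hαβ ht),
    hQ.hasDerivAt_queueMGF hβ hαβ ht,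
    (hQ.hasDerivWithinAt_queueMGF hμ hθ hlam hβ hαβ ht).congr_deriv ?_⟩
  rw [hQ.meanAt_erlangDepartureRate_mul_exp hβ hαβ ht, fluidHamiltonian, fluidDepartureRate_eq]
  ring

theorem continuousOn_uncurry_queueMGF (hQ : IsErlangA P ℱ lam μ θ c Q) (hμ : 0 ≤ μ) (hθ : 0 ≤ θ)
    (hlam : ContinuousOn lam (Icc 0 T)) (hβ : UniformExpMoment P Q T β) (hβ0 : 0 ≤ β)
    (hS : ∀ α ∈ S, α ≠ 0 → α < β) :
    ContinuousOn (Function.uncurry (queueMGF P Q)) (Icc 0 T ×ˢ S) := by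
  have hSβ : S ⊆ Iic β := fun α hα => by
    rcases eq_or_ne α 0 with rfl | hα0
    exacts [hβ0, (hS α hα hα0).le]
  refine continuousOn_uncurry_of_monotoneOn (fun α hα => ?_)
    (fun t ht => (hQ.continuousOn_queueMGF hβ ht).mono hSβ)
    (fun t ht => (monotoneOn_mgf_of_nonneg (hQ.aemeasurable_cast _)
      (ae_of_all P fun _ => Nat.cast_nonneg _) (hQ.integrable_exp hβ le_rfl ht)).mono hSβ)
  rcases eq_or_ne α 0 with rfl | hα0
  · simpa only [queueMGF, mgf_zero] using continuousOn_const
  · exact fun t ht =>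
      (hQ.hasDerivWithinAt_queueMGF hμ hθ hlam hβ (hS α hα hα0) ht).continuousWithinAt

theorem isSupersolution_queueMGF (hQ : IsErlangA P ℱ lam μ θ c Q) (hμ : 0 ≤ μ) (hθ : 0 ≤ θ)
    (hlam : ContinuousOn lam (Icc 0 T)) (hβ : UniformExpMoment P Q T β) (hβ0 : 0 ≤ β)
    (hS : ∀ α ∈ S, α ≠ 0 → α < β) (hsign : ∀ α ∈ S, 0 ≤ (μ - θ) * α) :
    IsSupersolution (fluidHamiltonian lam μ θ c) T S (queueMGF P Q) where
  continuousOn := hQ.continuousOn_uncurry_queueMGF hμ hθ hlam hβ hβ0 hS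
  le_deriv t ht α hα hα0 := by
    obtain ⟨p, gap, hgap, hp, hd⟩ :=
      hQ.exists_queueMGF_deriv_eq_sub_gap hμ hθ hlam hβ (hS α hα hα0) ht
    refine ⟨p, _, hp.hasDerivWithinAt, hd, ?_⟩
    linarith [exp_neg_sub_one_mul_nonpos (α := α) (x := (μ - θ) * gap)
      (by linarith [mul_nonneg (hsign α hα) hgap])]

theorem isSubsolution_queueMGF (hQ : IsErlangA P ℱ lam μ θ c Q) (hμ : 0 ≤ μ) (hθ : 0 ≤ θ)
    (hlam : ContinuousOn lam (Icc 0 T)) (hβ : UniformExpMoment P Q T β) (hβ0 : 0 ≤ β)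
    (hS : ∀ α ∈ S, α ≠ 0 → α < β) (hsign : ∀ α ∈ S, (μ - θ) * α ≤ 0) :
    IsSubsolution (fluidHamiltonian lam μ θ c) T S (queueMGF P Q) where
  continuousOn := hQ.continuousOn_uncurry_queueMGF hμ hθ hlam hβ hβ0 hS
  deriv_le t ht α hα hα0 := by
    obtain ⟨p, gap, hgap, hp, hd⟩ :=
      hQ.exists_queueMGF_deriv_eq_sub_gap hμ hθ hlam hβ (hS α hα hα0) ht
    refine ⟨p, _, hp.hasDerivWithinAt, hd, ?_⟩
    linarith [exp_neg_sub_one_mul_nonpos (α := α) (x := -((μ - θ) * gap))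
      (by linarith [mul_nonpos_of_nonpos_of_nonneg (hsign α hα) hgap])]

end IsErlangA

theorem exists_starConvex_subset_uIcc (α : ℝ) : ∃ S ⊆ uIcc 0 α, StarConvex ℝ 0 S ∧
    α ∈ closure S ∧ ∀ x ∈ S, x ≠ 0 → x < max α 0 := by
  rcases le_or_gt α 0 with hα | hα
  · exact ⟨Icc α 0, Icc_subset_uIcc', (convex_Icc α 0).starConvex (right_mem_Icc.2 hα),
      subset_closure (left_mem_Icc.2 hα), fun x hx hx0 => lt_max_of_lt_right (hx.2.lt_of_ne hx0)⟩
  · refine ⟨Ico 0 α, Ico_subset_Icc_self.trans Icc_subset_uIcc,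
      (convex_Ico 0 α).starConvex (left_mem_Ico.2 hα), ?_, fun x hx _ => lt_max_of_lt_left hx.2⟩
    rw [closure_Ico hα.ne]
    exact right_mem_Icc.2 hα.le

theorem mul_nonneg_of_mem_uIcc {k x : ℝ} (h : 0 ≤ k * α) (hx : x ∈ uIcc 0 α) : 0 ≤ k * x := by
  have hmem : k * x ∈ uIcc (k * 0) (k * α) :=
    image_const_mul_uIcc k 0 α ▸ mem_image_of_mem (k * ·) hx
  rw [mul_zero, uIcc_of_le h] at hmem
  exact hmem.1

theorem queueMGF_coe (t : ℝ≥0) : queueMGF P Q t = mgf (fun ω => (Q t ω : ℝ)) P := by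
  funext α
  rw [queueMGF, Real.toNNReal_coe]

/- `E[Q e^{αQ}]` may be infinite at the end point `α = max α 0 > 0`; there the comparison is
obtained by continuity from smaller exponents. -/
theorem IsErlangA.queueMGF_comparison [IsProbabilityMeasure P] {M : ℝ → ℝ → ℝ}
    (hQ : IsErlangA P ℱ lam μ θ c Q) (hM : IsFluidMGF lam μ θ c T J M) (hμ : 0 ≤ μ) (hθ : 0 ≤ θ)
    (hlam : ContinuousOn lam (Icc 0 T)) (hJ : J.OrdConnected) (hJ0 : (0 : ℝ) ∈ J) (hα : α ∈ J)
    (hβ : UniformExpMoment P Q T (max α 0)) (hinit : ∀ x ∈ J, M 0 x = queueMGF P Q 0 x)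
    (ht : t ∈ Icc 0 T) :
    (0 ≤ (μ - θ) * α → M t α ≤ queueMGF P Q t α) ∧
      ((μ - θ) * α ≤ 0 → queueMGF P Q t α ≤ M t α) := by
  obtain ⟨S, hSα, hS, hα_closure, hSβ⟩ := exists_starConvex_subset_uIcc α
  have hSJ : S ⊆ J := hSα.trans (hJ.uIcc_subset hJ0 hα)
  have hzero : ∀ t ∈ Icc 0 T, M t 0 = queueMGF P Q t 0 := fun t ht => by
    rw [hM.apply_zero_eq hJ0 t ht, hinit 0 hJ0, queueMGF, queueMGF, mgf_zero, mgf_zero]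
  have hM_cont : ContinuousWithinAt (M t) S α :=
    (hM.cont.uncurry_left t ht α hα).mono hSJ
  have hQ_cont : ContinuousWithinAt (queueMGF P Q t) S α :=
    (hQ.continuousOn_queueMGF hβ ht α (le_max_left α 0)).mono fun x hx =>
      (hSα hx).2.trans_eq (max_comm 0 α)
  constructor <;> intro hsign
  · exact hM_cont.closure_le hα_closure hQ_cont (fluid_comparison hμ hθ hlam hS
      (hM.isSubsolution.mono hSJ) (hQ.isSupersolution_queueMGF hμ hθ hlam hβ (le_max_right α 0) hSβ
        fun x hx => mul_nonneg_of_mem_uIcc hsign (hSα hx))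
      (fun x hx => (hinit x (hSJ hx)).le) (fun t ht => (hzero t ht).le) t ht)
  · refine hQ_cont.closure_le hα_closure hM_cont (fluid_comparison hμ hθ hlam hS
      (hQ.isSubsolution_queueMGF hμ hθ hlam hβ (le_max_right α 0) hSβ
        fun x hx => ?_) (hM.isSupersolution.mono hSJ)
      (fun x hx => (hinit x (hSJ hx)).ge) (fun t ht => (hzero t ht).ge) t ht)
    have := mul_nonneg_of_mem_uIcc (k := -(μ - θ)) (by linarith) (hSα hx)
    linarith

end Comparison

theorem mainTheorem4 {Ω : Type*} [mΩ : MeasurableSpace Ω] (P : Measure Ω) [IsProbabilityMeasure P]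
    (ℱ : Filtration ℝ≥0 mΩ) (lam : ℝ → ℝ) (μ θ : ℝ) (c : ℕ)
    (hlam_cont : ContinuousOn lam (Ici 0)) (hlam_nonneg : ∀ t, 0 ≤ t → 0 ≤ lam t)
    (hμ : 0 < μ) (hθ : 0 ≤ θ) (hc : 0 < c)
    (Q : ℝ≥0 → Ω → ℕ) (hQ : IsErlangA P ℱ lam μ θ c Q)
    (T : ℝ) (J : Set ℝ) (hJ : J.OrdConnected) (hJ0 : (0 : ℝ) ∈ J)
    (Mf : ℝ → ℝ → ℝ) (hMf : IsFluidMGF lam μ θ c T J Mf)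
    (hinit_int : ∀ α ∈ J, Integrable (fun ω => Real.exp (α * (Q 0 ω : ℝ))) P)
    (hinit : ∀ α ∈ J, Mf 0 α = mgf (fun ω => (Q 0 ω : ℝ)) P α) :
    ∀ t : ℝ≥0, (t : ℝ) ≤ T → ∀ α ∈ J,
      Integrable (fun ω => Real.exp (α * (Q t ω : ℝ))) P ∧
      (0 ≤ α →
        (θ < μ → Real.log (Mf t α) ≤ cgf (fun ω => (Q t ω : ℝ)) P α) ∧
        (μ < θ → cgf (fun ω => (Q t ω : ℝ)) P α ≤ Real.log (Mf t α))) ∧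
      (α ≤ 0 →
        (θ < μ → cgf (fun ω => (Q t ω : ℝ)) P α ≤ Real.log (Mf t α)) ∧
        (μ < θ → Real.log (Mf t α) ≤ cgf (fun ω => (Q t ω : ℝ)) P α)) ∧
      (θ = μ → cgf (fun ω => (Q t ω : ℝ)) P α = Real.log (Mf t α)) := by
  intro t htT α hα
  have ht : (t : ℝ) ∈ Icc 0 T := ⟨t.2, htT⟩
  have hlam : ContinuousOn lam (Icc 0 T) := hlam_cont.mono Icc_subset_Ici_self
  have hβ : UniformExpMoment P Q T (max α 0) :=
    hQ.uniformExpMoment hμ.le hθ hlam (fun s hs => hlam_nonneg s hs.1) (le_max_right α 0)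
      (hinit_int _ (by rcases max_choice α 0 with h | h <;> rwa [h]))
  have hint : Integrable (fun ω => Real.exp (α * Q t ω)) P := by
    simpa only [Real.toNNReal_coe] using hQ.integrable_exp hβ (le_max_left α 0) ht
  obtain ⟨hle, hge⟩ := hQ.queueMGF_comparison hMf hμ.le hθ hlam hJ hJ0 hα hβ
    (by simpa only [queueMGF, Real.toNNReal_zero] using hinit) ht
  rw [queueMGF_coe] at hle hge
  have hlog_le (h : 0 ≤ (μ - θ) * α) : Real.log (Mf t α) ≤ cgf (fun ω => (Q t ω : ℝ)) P α :=
    Real.log_le_log (hMf.pos t ht α hα) (hle h)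
  have hlog_ge (h : (μ - θ) * α ≤ 0) : cgf (fun ω => (Q t ω : ℝ)) P α ≤ Real.log (Mf t α) :=
    Real.log_le_log (mgf_pos hint) (hge h)
  refine ⟨hint, fun h0 => ⟨fun h => hlog_le ?_, fun h => hlog_ge ?_⟩,
    fun h0 => ⟨fun h => hlog_ge ?_, fun h => hlog_le ?_⟩, fun h => ?_⟩
  · exact mul_nonneg (sub_nonneg.2 h.le) h0
  · exact mul_nonpos_of_nonpos_of_nonneg (sub_nonpos.2 h.le) h0
  · exact mul_nonpos_of_nonneg_of_nonpos (sub_nonneg.2 h.le) h0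
  · exact mul_nonneg_of_nonpos_of_nonpos (sub_nonpos.2 h.le) h0
  · exact (hlog_ge (by simp [h])).antisymm (hlog_le (by simp [h]))
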